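/- Let $G$ be a real Lie group and let $G$ act on the left, by a $C^\infty$ action $G\times M\to M$, on a (Hausdorff, $C^\infty$, finite-dimensional, not necessarily connected) manifold $M$ of dimension $n$. For an integer $\ell\ge 1$ let $\mathscr F^\ell M$ be the frame bundle of order $\ell$ of $M$, i.e. the manifold of $\ell$-jets at $0$ of $C^\infty$ local diffeomorphisms $\varphi$ from neighbourhoods of $0$ in $\mathbb R^n$ into $M$, on which $G$ acts by prolongation: $g\cdot j^\ell_0\varphi=j^\ell_0(g\circ\varphi)$. Call the action of $G$ on $M$ component effective if for every $g\in G\setminus\{1_G\}$ and every connected component $M^\circ$ of $M$ there is $x\in M^\circ$ with $gx\neq x$. Assume that the $G$-action on $M$ is component effective, and let $\ell\ge 1$. If the $G$-action on $\mathscr F^\ell M$ is proper (the map $G\times\mathscr F^\ell M\to\mathscr F^\ell M\times\mathscr F^\ell M$, $(g,x)\mapsto(gx,x)$, is proper), then the $G$-action on $\mathscr F^\ell M$ is free, i.e. $\{g\in G: gx=x\}=\{1_G\}$ for every $x\in\mathscr F^\ell M$. -/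

import Mathlib

open scoped Manifold ContDiff

noncomputable section

/-- An action of `G` on a topological space `X` is component effective if every nontrivial element
of `G` moves some point of every connected component of `X`. -/
def ComponentEffective (G X : Type*) [Group G] [TopologicalSpace X] [MulAction G X] : Prop :=
  ∀ g : G, g ≠ 1 → ∀ x₀ : X, ∃ x ∈ connectedComponent x₀, g • x ≠ x

/-- An action of a group `G` on a set `X` is free if all stabilizers are trivial. -/
def IsFreeAction (G X : Type*) [Group G] [MulAction G X] : Prop :=
  ∀ x : X, MulAction.stabilizer G x = ⊥

/-- A local parametrization of the `n`-manifold `M` at the origin: a map that restricts to a `C^∞`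
diffeomorphism from an open neighbourhood of `0` in `ℝⁿ` onto an open subset of `M`.
Its values away from `0` play no role once one passes to jets at `0`. -/
@[ext] structure LocalParam (n : ℕ) (M : Type*) [TopologicalSpace M]
    [ChartedSpace (EuclideanSpace ℝ (Fin n)) M] where
  toFun : EuclideanSpace ℝ (Fin n) → M
  isLocalDiffeomorphAt : IsLocalDiffeomorphAt (𝓡 n) (𝓡 n) ∞ toFun 0

namespace LocalParam

variable {n : ℕ} {M : Type*} [TopologicalSpace M] [ChartedSpace (EuclideanSpace ℝ (Fin n)) M]

/-- The space of coordinates of `k`-jets at `0` of maps from `ℝⁿ` to `ℝⁿ`: a value together with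
derivatives of orders `1, …, k`, the derivative of order `i` being an `i`-linear map. -/
abbrev JetCoord (n k : ℕ) : Type :=
  (i : Fin (k + 1)) →
    ContinuousMultilinearMap ℝ (fun _ : Fin i => EuclideanSpace ℝ (Fin n))
      (EuclideanSpace ℝ (Fin n))

/-- The derivatives at `0`, of orders `0, …, k`, of a local parametrization read in a chart `e`
(meaningful if `φ 0` lies in the domain of `e`). -/
def jetCoord (k : ℕ) (e : OpenPartialHomeomorph M (EuclideanSpace ℝ (Fin n)))
    (φ : LocalParam n M) : JetCoord n k :=
  fun i => iteratedFDeriv ℝ i (e ∘ φ.toFun) 0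

/-- Two local parametrizations have the same `k`-jet at `0` if they have the same value at `0` and
the same derivatives at `0` up to order `k` in every `C^∞` chart of `M` around that value. -/
def SameJet (k : ℕ) (φ ψ : LocalParam n M) : Prop :=
  φ.toFun 0 = ψ.toFun 0 ∧
    ∀ e ∈ IsManifold.maximalAtlas (𝓡 n) ∞ M, φ.toFun 0 ∈ e.source →
      jetCoord k e φ = jetCoord k e ψ

variable (n M) in
/-- Having the same `k`-jet at `0`, as an equivalence relation. -/
def jetSetoid (k : ℕ) : Setoid (LocalParam n M) where
  r := SameJet k
  iseqv :=
    { refl := fun _ => ⟨rfl, fun _ _ _ => rfl⟩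
      symm := fun h => ⟨h.1.symm, fun e he hs => (h.2 e he (h.1 ▸ hs)).symm⟩
      trans := fun h h' => ⟨h.1.trans h'.1, fun e he hs =>
        (h.2 e he hs).trans (h'.2 e he (h.1 ▸ hs))⟩ }

/-- Composition of a local parametrization with a diffeomorphism of `M`. -/
def postcomp (f : M ≃ₘ^∞⟮𝓡 n, 𝓡 n⟯ M) (φ : LocalParam n M) : LocalParam n M where
  toFun := f ∘ φ.toFun
  isLocalDiffeomorphAt := φ.isLocalDiffeomorphAt.comp (𝓡 n) M (f.isLocalDiffeomorph (φ.toFun 0))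

/-- A chart composed with a diffeomorphism is again a chart of the maximal atlas. -/
theorem diffeo_trans_mem_maximalAtlas [IsManifold (𝓡 n) ∞ M] (f : M ≃ₘ^∞⟮𝓡 n, 𝓡 n⟯ M)
    {e : OpenPartialHomeomorph M (EuclideanSpace ℝ (Fin n))}
    (he : e ∈ IsManifold.maximalAtlas (𝓡 n) ∞ M) :
    f.toHomeomorph.toOpenPartialHomeomorph.trans e ∈ IsManifold.maximalAtlas (𝓡 n) ∞ M := by
  rw [IsManifold.mem_maximalAtlas_iff_contMDiffOn]
  constructor
  · exact (contMDiffOn_of_mem_maximalAtlas he).comp f.contMDiff.contMDiffOn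
      (fun x hx => by simpa using hx)
  · exact f.symm.contMDiff.comp_contMDiffOn
      ((contMDiffOn_symm_of_mem_maximalAtlas he).mono (fun x hx => by simpa using hx))

theorem SameJet.postcomp [IsManifold (𝓡 n) ∞ M] {k : ℕ} (f : M ≃ₘ^∞⟮𝓡 n, 𝓡 n⟯ M)
    {φ ψ : LocalParam n M} (h : SameJet k φ ψ) : SameJet k (φ.postcomp f) (ψ.postcomp f) :=
  ⟨congrArg f h.1, fun _ he hs => h.2 _ (diffeo_trans_mem_maximalAtlas f he) ⟨trivial, hs⟩⟩

end LocalParam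

/-- The frame bundle of order `k` of the `n`-manifold `M`: the set of `k`-jets at `0` of local
parametrizations of `M`. -/
def FrameBundle (n k : ℕ) (M : Type*) [TopologicalSpace M]
    [ChartedSpace (EuclideanSpace ℝ (Fin n)) M] : Type _ :=
  Quotient (LocalParam.jetSetoid n M k)

namespace FrameBundle

variable {n : ℕ} {k : ℕ} {M : Type*} [TopologicalSpace M]
  [ChartedSpace (EuclideanSpace ℝ (Fin n)) M]

/-- The `k`-jet at `0` of a local parametrization. -/
def jet (k : ℕ) (φ : LocalParam n M) : FrameBundle n k M :=
  Quotient.mk (LocalParam.jetSetoid n M k) φ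

/-- The set of frames based in the domain of the chart `e`, with coordinates in the set `V`. -/
def chartBox (e : OpenPartialHomeomorph M (EuclideanSpace ℝ (Fin n)))
    (V : Set (LocalParam.JetCoord n k)) : Set (FrameBundle n k M) :=
  jet k '' {φ | φ.toFun 0 ∈ e.source ∧ φ.jetCoord k e ∈ V}

/-- For a chart of the maximal atlas, membership in a chart box may be tested on any
representative. -/
theorem jet_mem_chartBox {e : OpenPartialHomeomorph M (EuclideanSpace ℝ (Fin n))}
    (he : e ∈ IsManifold.maximalAtlas (𝓡 n) ∞ M) {V : Set (LocalParam.JetCoord n k)}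
    {φ : LocalParam n M} :
    jet k φ ∈ chartBox e V ↔ φ.toFun 0 ∈ e.source ∧ φ.jetCoord k e ∈ V := by
  constructor
  · rintro ⟨ψ, ⟨hs, hV⟩, h⟩
    have h' : LocalParam.SameJet k ψ φ := Quotient.exact h
    exact ⟨h'.1 ▸ hs, h'.2 e he hs ▸ hV⟩
  · exact fun h => ⟨φ, h, rfl⟩

/-- The manifold topology of the frame bundle: the open sets are the unions of (finite intersections
of) chart boxes over open sets of coordinates, so that the coordinates of a frame with respect to a
chart of `M` are a homeomorphism from the set of frames based in the domain of the chart onto a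
subspace of the space of jet coordinates. -/
instance : TopologicalSpace (FrameBundle n k M) :=
  TopologicalSpace.generateFrom
    {U | ∃ e ∈ IsManifold.maximalAtlas (𝓡 n) ∞ M, ∃ V : Set (LocalParam.JetCoord n k),
      IsOpen V ∧ U = chartBox e V}

/-- The map induced on frames by a diffeomorphism `f` of `M`: it sends the jet of `φ` to the jet of
`f ∘ φ`. -/
def map [IsManifold (𝓡 n) ∞ M] (f : M ≃ₘ^∞⟮𝓡 n, 𝓡 n⟯ M) :
    FrameBundle n k M → FrameBundle n k M :=
  Quotient.map (LocalParam.postcomp f) (fun _ _ h => LocalParam.SameJet.postcomp f h)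

/-- The prolongation to the frame bundle of order `k` of a `C^∞` action of the Lie group `G` (of
dimension `m`) on `M`: the element `g` sends the jet of `φ` to the jet of `x ↦ g • φ x`. -/
@[reducible] def prolongedAction (m n k : ℕ) (G M : Type*) [Group G] [TopologicalSpace G]
    [ChartedSpace (EuclideanSpace ℝ (Fin m)) G] [TopologicalSpace M]
    [ChartedSpace (EuclideanSpace ℝ (Fin n)) M] [IsManifold (𝓡 n) ∞ M] [MulAction G M]
    [ContMDiffSMul (𝓡 m) (𝓡 n) ∞ G M] : MulAction G (FrameBundle n k M) where
  smul g := map (Diffeomorph.smul (𝓡 m) (𝓡 n) ∞ g)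
  one_smul := by
    rintro ⟨φ⟩
    exact congrArg (jet k) (LocalParam.ext (funext fun x => one_smul G (φ.toFun x)))
  mul_smul := by
    rintro g h ⟨φ⟩
    exact congrArg (jet k) (LocalParam.ext (funext fun x => mul_smul g h (φ.toFun x)))

end FrameBundle

end

open Filter Topology Set

/-! Properness makes the stabilizer `K` of a frame compact. Since `1 ≤ ℓ`, every `k ∈ K` fixes the
base point with derivative the identity. Compactness upgrades this to triviality near the base
point: on a small ball in a chart all of `K` is uniformly C¹-close to the identity, so if `k` moved
`w`, the points `k ^ j • w` would drift off linearly, although they stay in a ball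
(`eventually_forall_smul_eq_of_fderiv_eq_id`). This replaces averaging or an invariant metric. The
same lemma, applied at limit points, shows that the interior of the fixed set of `K` is closed. So
`K` fixes the whole component of the base point, and component effectiveness gives `K = ⊥`. -/

/-- A bounded sequence whose increments all stay close to the first one has first increment `0`. -/
theorem eq_of_bounded_of_norm_increment_sub_le {E : Type*} [NormedAddCommGroup E]
    [NormedSpace ℝ E] (a : ℕ → E) (C : ℝ) (hC : ∀ j, ‖a j - a 0‖ ≤ C)
    (h : ∀ j, ‖a (j + 1) - a j - (a 1 - a 0)‖ ≤ 1 / 2 * ‖a 1 - a 0‖) : a 1 = a 0 := by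
  have key : ∀ N : ℕ, ‖a N - a 0 - (N : ℝ) • (a 1 - a 0)‖ ≤ N * (1 / 2 * ‖a 1 - a 0‖) := by
    intro N
    induction N with
    | zero => simp
    | succ N ih =>
      have e : a (N + 1) - a 0 - ((N + 1 : ℕ) : ℝ) • (a 1 - a 0)
          = (a N - a 0 - (N : ℝ) • (a 1 - a 0)) + (a (N + 1) - a N - (a 1 - a 0)) := by
        push_cast
        rw [add_smul, one_smul]
        abel
      rw [e]
      refine (norm_add_le _ _).trans ((add_le_add ih (h N)).trans (le_of_eq ?_))
      push_cast
      ring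
  by_contra hne
  have hpos : 0 < ‖a 1 - a 0‖ := norm_pos_iff.2 (sub_ne_zero.2 hne)
  -- `key` gives `‖a N - a 0‖ ≥ N / 2 * ‖a 1 - a 0‖`, which exceeds `C` for this `N`.
  obtain ⟨N, hN⟩ := exists_nat_gt (2 * C / ‖a 1 - a 0‖)
  rw [div_lt_iff₀ hpos] at hN
  have h1 : ‖(N : ℝ) • (a 1 - a 0)‖ ≤ ‖a N - a 0‖ + ‖a N - a 0 - (N : ℝ) • (a 1 - a 0)‖ := by
    have := norm_sub_le (a N - a 0) (a N - a 0 - (N : ℝ) • (a 1 - a 0))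
    rwa [sub_sub_cancel] at this
  rw [norm_smul, Real.norm_natCast] at h1
  have h2 := key N
  have h3 := hC N
  linarith

/-! ### The action in charts -/

section ChartSMul

variable {m n : ℕ} {G M : Type*} [TopologicalSpace M] [ChartedSpace (EuclideanSpace ℝ (Fin n)) M]
  [Group G] [MulAction G M]

/-- The action of `g` on `M`, read in the preferred chart at `y` on both sides. -/
def chartSMul (y : M) (g : G) (z : EuclideanSpace ℝ (Fin n)) : EuclideanSpace ℝ (Fin n) :=
  chartAt (EuclideanSpace ℝ (Fin n)) y
    (g • (chartAt (EuclideanSpace ℝ (Fin n)) y).symm z)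

variable [TopologicalSpace G] [ChartedSpace (EuclideanSpace ℝ (Fin m)) G]
  [LieGroup (𝓡 m) ∞ G] [IsManifold (𝓡 n) ∞ M] [ContMDiffSMul (𝓡 m) (𝓡 n) ∞ G M]

include m in
omit [LieGroup (𝓡 m) ∞ G] [IsManifold (𝓡 n) ∞ M] in
theorem continuousAt_smul_chart_symm (y : M) (g : G) (z : EuclideanSpace ℝ (Fin n))
    (hz : z ∈ (chartAt (EuclideanSpace ℝ (Fin n)) y).target) :
    ContinuousAt (fun p : EuclideanSpace ℝ (Fin n) × G =>
      p.2 • (chartAt (EuclideanSpace ℝ (Fin n)) y).symm p.1) (z, g) := by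
  have : ContinuousSMul G M := ContMDiffSMul.continuousSMul (I := 𝓡 m) (I' := 𝓡 n) ∞
  have h := (chartAt (EuclideanSpace ℝ (Fin n)) y).continuousAt_symm hz
  exact continuousAt_snd.smul (ContinuousAt.comp' (f := Prod.fst) (x := (z, g)) h continuousAt_fst)

/-- The action in charts of `G` and of `M` is smooth. -/
theorem contDiffAt_chartSMul_chart (y : M) (g : G) (z : EuclideanSpace ℝ (Fin n))
    (hz : z ∈ (chartAt (EuclideanSpace ℝ (Fin n)) y).target)
    (hg : g • (chartAt (EuclideanSpace ℝ (Fin n)) y).symm z ∈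
      (chartAt (EuclideanSpace ℝ (Fin n)) y).source) :
    ContDiffAt ℝ ∞ (fun p : EuclideanSpace ℝ (Fin m) × EuclideanSpace ℝ (Fin n) =>
      chartSMul y ((chartAt (EuclideanSpace ℝ (Fin m)) g).symm p.1) p.2)
      (chartAt (EuclideanSpace ℝ (Fin m)) g g, z) := by
  rw [← contMDiffAt_iff_contDiffAt]
  have h1 : ContMDiffAt (𝓡 m) (𝓡 m) ∞ (chartAt (EuclideanSpace ℝ (Fin m)) g).symm
      (chartAt (EuclideanSpace ℝ (Fin m)) g g) :=
    contMDiffAt_symm_of_mem_maximalAtlas (IsManifold.chart_mem_maximalAtlas g)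
      (mem_chart_target _ g)
  have h2 : ContMDiffAt (𝓡 n) (𝓡 n) ∞ (chartAt (EuclideanSpace ℝ (Fin n)) y).symm z :=
    contMDiffAt_symm_of_mem_maximalAtlas (IsManifold.chart_mem_maximalAtlas y) hz
  have h3 : ContMDiffAt (𝓡 n) (𝓡 n) ∞ (chartAt (EuclideanSpace ℝ (Fin n)) y)
      (g • (chartAt (EuclideanSpace ℝ (Fin n)) y).symm z) :=
    contMDiffAt_of_mem_maximalAtlas (IsManifold.chart_mem_maximalAtlas y) hg
  have hgg : (chartAt (EuclideanSpace ℝ (Fin m)) g).symm (chartAt (EuclideanSpace ℝ (Fin m)) g g)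
      = g := (chartAt (EuclideanSpace ℝ (Fin m)) g).left_inv (mem_chart_source _ g)
  have h4 : ContMDiffAt 𝓘(ℝ, EuclideanSpace ℝ (Fin m) × EuclideanSpace ℝ (Fin n)) (𝓡 n) ∞
      (fun p : EuclideanSpace ℝ (Fin m) × EuclideanSpace ℝ (Fin n) =>
        (chartAt (EuclideanSpace ℝ (Fin m)) g).symm p.1 •
          (chartAt (EuclideanSpace ℝ (Fin n)) y).symm p.2)
      (chartAt (EuclideanSpace ℝ (Fin m)) g g, z) :=
    ContMDiffAt.smul
      (h1.comp (chartAt (EuclideanSpace ℝ (Fin m)) g g, z) contDiffAt_fst.contMDiffAt)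
      (h2.comp (chartAt (EuclideanSpace ℝ (Fin m)) g g, z) contDiffAt_snd.contMDiffAt)
  refine ContMDiffAt.comp (chartAt (EuclideanSpace ℝ (Fin m)) g g, z) ?_ h4
  simpa only [hgg] using h3

include m in
theorem contDiffAt_chartSMul (y : M) (g : G) (z : EuclideanSpace ℝ (Fin n))
    (hz : z ∈ (chartAt (EuclideanSpace ℝ (Fin n)) y).target)
    (hg : g • (chartAt (EuclideanSpace ℝ (Fin n)) y).symm z ∈
      (chartAt (EuclideanSpace ℝ (Fin n)) y).source) :
    ContDiffAt ℝ ∞ (chartSMul y g) z := by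
  have h := (contDiffAt_chartSMul_chart (m := m) y g z hz hg).comp z
    (contDiffAt_const.prodMk contDiffAt_id)
  have hgg : (chartAt (EuclideanSpace ℝ (Fin m)) g).symm (chartAt (EuclideanSpace ℝ (Fin m)) g g)
      = g := (chartAt (EuclideanSpace ℝ (Fin m)) g).left_inv (mem_chart_source _ g)
  simpa only [Function.comp_def, hgg, id] using h

include m in
/-- The derivative in the chart depends continuously on the point and on the group element. -/
theorem continuousAt_fderiv_chartSMul (y : M) (g : G) (z : EuclideanSpace ℝ (Fin n))
    (hz : z ∈ (chartAt (EuclideanSpace ℝ (Fin n)) y).target)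
    (hg : g • (chartAt (EuclideanSpace ℝ (Fin n)) y).symm z ∈
      (chartAt (EuclideanSpace ℝ (Fin n)) y).source) :
    ContinuousAt (fun p : EuclideanSpace ℝ (Fin n) × G => fderiv ℝ (chartSMul y p.2) p.1)
      (z, g) := by
  set c := chartAt (EuclideanSpace ℝ (Fin m)) g with hc
  -- A chart of `G` turns the group element into a vector parameter, so that joint smoothness yields
  -- continuity of the partial derivative in the point.
  have h1 : ContDiffAt ℝ 0 (fun p : EuclideanSpace ℝ (Fin m) × EuclideanSpace ℝ (Fin n) =>
      fderiv ℝ (fun w => chartSMul y (c.symm p.1) w) p.2) (c g, z) := by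
    refine ContDiffAt.fderiv (n := ∞)
      (f := fun (p : EuclideanSpace ℝ (Fin m) × EuclideanSpace ℝ (Fin n)) w =>
        chartSMul y (c.symm p.1) w) (g := Prod.snd) ?_ contDiffAt_snd (by simp)
    have h0 := contDiffAt_chartSMul_chart (m := m) y g z hz hg
    exact ContDiffAt.comp
      (f := fun q : (EuclideanSpace ℝ (Fin m) × EuclideanSpace ℝ (Fin n)) ×
        EuclideanSpace ℝ (Fin n) => (q.1.1, q.2)) ((c g, z), z) h0
      (contDiffAt_fst.fst.prodMk contDiffAt_snd)
  have h2 : ContinuousAt (fun p : EuclideanSpace ℝ (Fin n) × G => (c p.2, p.1)) (z, g) :=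
    (ContinuousAt.comp' (f := Prod.snd) (x := (z, g)) (c.continuousAt (mem_chart_source _ g))
      continuousAt_snd).prodMk continuousAt_fst
  have h3 := ContinuousAt.comp' (x := (z, g)) h1.continuousAt h2
  refine h3.congr ?_
  have h4 : ∀ᶠ p : EuclideanSpace ℝ (Fin n) × G in 𝓝 (z, g), p.2 ∈ c.source :=
    continuousAt_snd.eventually (c.open_source.mem_nhds (mem_chart_source _ g))
  filter_upwards [h4] with p hp
  simp only [c.left_inv hp]

/-! ### Rigidity of compact groups near a fixed point -/

include m in
/-- A compact group of transformations that fixes a point to first order acts trivially near that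
point. -/
theorem eventually_forall_smul_eq_of_fderiv_eq_id (K : Subgroup G) (hK : IsCompact (K : Set G))
    (y : M) (hfix : ∀ k ∈ K, k • y = y)
    (hD : ∀ k ∈ K, fderiv ℝ (chartSMul y k) (chartAt (EuclideanSpace ℝ (Fin n)) y y)
      = ContinuousLinearMap.id ℝ _) :
    ∀ᶠ x in 𝓝 y, ∀ k ∈ K, k • x = x := by
  set e := chartAt (EuclideanSpace ℝ (Fin n)) y with he
  have hys : y ∈ e.source := mem_chart_source _ y
  have hyt : e y ∈ e.target := mem_chart_target _ y
  have hsy : e.symm (e y) = y := e.left_inv hys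
  -- Compactness of `K` gives one neighbourhood of `e y` that serves all `k` at once.
  have hev : ∀ᶠ z in 𝓝 (e y), ∀ k ∈ (K : Set G), z ∈ e.target ∧ k • e.symm z ∈ e.source ∧
      ‖fderiv ℝ (chartSMul y k) z - ContinuousLinearMap.id ℝ _‖ ≤ 1 / 2 := by
    refine hK.eventually_forall_of_forall_eventually fun k hk => ?_
    have hks : k • e.symm (e y) ∈ e.source := by rw [hsy, hfix k hk]; exact hys
    have h1 : ∀ᶠ p : EuclideanSpace ℝ (Fin n) × G in 𝓝 (e y, k), p.1 ∈ e.target :=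
      continuousAt_fst.eventually (e.open_target.mem_nhds hyt)
    have h2 : ∀ᶠ p : EuclideanSpace ℝ (Fin n) × G in 𝓝 (e y, k), p.2 • e.symm p.1 ∈ e.source :=
      (continuousAt_smul_chart_symm (m := m) y k (e y) hyt).eventually
        (e.open_source.mem_nhds hks)
    have h3 : ∀ᶠ p : EuclideanSpace ℝ (Fin n) × G in 𝓝 (e y, k),
        fderiv ℝ (chartSMul y p.2) p.1 ∈
          Metric.closedBall (ContinuousLinearMap.id ℝ (EuclideanSpace ℝ (Fin n))) (1 / 2) := by
      refine (continuousAt_fderiv_chartSMul (m := m) y k (e y) hyt hks).eventually ?_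
      simp only [hD k hk]
      exact Metric.closedBall_mem_nhds _ (by norm_num)
    filter_upwards [h1, h2, h3] with p a b c
    exact ⟨a, b, by simpa [dist_eq_norm] using c⟩
  obtain ⟨r, hr, hball⟩ := Metric.eventually_nhds_iff_ball.1 hev
  -- Mean value inequality for `chartSMul y k - id` on a convex ball.
  have hlip : ∀ k ∈ K, ∀ w ∈ Metric.ball (e y) r, ∀ v ∈ Metric.ball (e y) r,
      ‖chartSMul y k v - chartSMul y k w - (v - w)‖ ≤ 1 / 2 * ‖v - w‖ := by
    intro k hk w hw v hv
    refine (convex_ball (e y) r).norm_image_sub_le_of_norm_fderiv_le'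
      (φ := ContinuousLinearMap.id ℝ (EuclideanSpace ℝ (Fin n))) (fun z hz => ?_)
      (fun z hz => (hball z hz k hk).2.2) hw hv
    exact (contDiffAt_chartSMul (m := m) y k z (hball z hz k hk).1
      (hball z hz k hk).2.1).differentiableAt (by simp)
  have hfixe : ∀ k ∈ K, chartSMul y k (e y) = e y := by
    intro k hk
    rw [chartSMul, ← he, hsy, hfix k hk]
  -- Distances to `e y` grow by a factor of at most `3 / 2`, so the half ball stays in the ball
  -- under all of `K`, hence under all powers of `k`.
  have hbound : ∀ k ∈ K, ∀ w ∈ Metric.ball (e y) (r / 2), chartSMul y k w ∈ Metric.ball (e y) r := by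
    intro k hk w hw
    have hw' : w ∈ Metric.ball (e y) r := Metric.ball_subset_ball (by linarith) hw
    have h := hlip k hk (e y) (Metric.mem_ball_self hr) w hw'
    rw [hfixe k hk] at h
    rw [mem_ball_iff_norm] at hw ⊢
    have := norm_add_le (chartSMul y k w - e y - (w - e y)) (w - e y)
    rw [sub_add_cancel] at this
    linarith
  have htriv : ∀ k ∈ K, ∀ w ∈ Metric.ball (e y) (r / 2), chartSMul y k w = w := by
    intro k hk w hw
    have hw' : w ∈ Metric.ball (e y) r := Metric.ball_subset_ball (by linarith) hw
    have hwt : w ∈ e.target := (hball w hw' k hk).1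
    have h0 : chartSMul y (1 : G) w = w := by
      rw [chartSMul, ← he, one_smul, e.right_inv hwt]
    have hsucc : ∀ j : ℕ, chartSMul y (k ^ (j + 1)) w = chartSMul y (k ^ j) (chartSMul y k w) := by
      intro j
      have : e.symm (chartSMul y k w) = k • e.symm w := e.left_inv (hball w hw' k hk).2.1
      rw [chartSMul, chartSMul, ← he, this, pow_succ, mul_smul]
    -- The `j`-th increment is the difference of the values of `k ^ j` at `k • w` and at `w`; `hlip`
    -- for `k ^ j` compares it with the first increment. The bound `2 * r` is the diameter of the
    -- ball.
    have h := eq_of_bounded_of_norm_increment_sub_le (fun j => chartSMul y (k ^ j) w) (2 * r)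
      (fun j => by
        have a := hbound _ (K.pow_mem hk j) w hw
        simp only [pow_zero, h0]
        rw [← dist_eq_norm]
        have := dist_triangle_right (chartSMul y (k ^ j) w) w (e y)
        rw [Metric.mem_ball] at a hw'
        linarith)
      (fun j => by
        simp only [pow_zero, h0, pow_one, hsucc]
        exact hlip _ (K.pow_mem hk j) w hw' _ (hbound k hk w hw))
    simpa only [pow_zero, pow_one, h0] using h
  have hnear : ∀ᶠ x in 𝓝 y, e x ∈ Metric.ball (e y) (r / 2) :=
    (e.continuousAt hys).eventually (Metric.ball_mem_nhds _ (by linarith))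
  filter_upwards [hnear, e.open_source.mem_nhds hys] with x hx hxs k hk
  have h1 := htriv k hk (e x) hx
  have h2 := (hball (e x) (Metric.ball_subset_ball (by linarith) hx) k hk).2.1
  rw [chartSMul, ← he] at h1
  rw [e.left_inv hxs] at h1 h2
  exact e.injOn h2 hxs h1

/-! ### Propagation along components -/

include m n in
/-- The interior of the fixed point set of a compact group of transformations is clopen. -/
theorem isClopen_setOf_eventually_forall_smul_eq [T2Space M] (K : Subgroup G)
    (hK : IsCompact (K : Set G)) :
    IsClopen {y : M | ∀ᶠ x in 𝓝 y, ∀ k ∈ K, k • x = x} := by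
  have : ContinuousSMul G M := ContMDiffSMul.continuousSMul (I := 𝓡 m) (I' := 𝓡 n) ∞
  set S := {y : M | ∀ᶠ x in 𝓝 y, ∀ k ∈ K, k • x = x} with hS
  -- Only closedness needs work: both the fixed point condition and the identity derivative pass to
  -- limits, and rigidity then applies at the limit point.
  refine ⟨isClosed_of_closure_subset fun y hy => ?_, isOpen_setOfPred_eventually_nhds⟩
  set e := chartAt (EuclideanSpace ℝ (Fin n)) y with he
  have hys : y ∈ e.source := mem_chart_source _ y
  have hyt : e y ∈ e.target := mem_chart_target _ y
  have hsy : e.symm (e y) = y := e.left_inv hys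
  have hfix : ∀ k ∈ K, k • y = y := by
    intro k hk
    have hcl : IsClosed {x : M | k • x = x} := isClosed_eq (continuous_const_smul k) continuous_id
    exact hcl.closure_subset_iff.2 (fun x hx => (Eventually.self_of_nhds hx) k hk) hy
  refine eventually_forall_smul_eq_of_fderiv_eq_id (m := m) (n := n) K hK y hfix fun k hk => ?_
  have hks : k • e.symm (e y) ∈ e.source := by rw [hsy, hfix k hk]; exact hys
  have hcont : ContinuousAt (fun x => fderiv ℝ (chartSMul y k) (e x)) y :=
    ContinuousAt.comp' (f := fun x => (e x, k)) (x := y)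
      (continuousAt_fderiv_chartSMul (m := m) y k (e y) hyt hks)
      ((e.continuousAt hys).prodMk continuousAt_const)
  have hfreq : ∃ᶠ x in 𝓝 y, fderiv ℝ (chartSMul y k) (e x) = ContinuousLinearMap.id ℝ _ := by
    refine ((mem_closure_iff_frequently.1 hy).and_eventually
      (e.open_source.mem_nhds hys)).mono ?_
    rintro x ⟨hx, hxs⟩
    have hev : ∀ᶠ z in 𝓝 (e x), chartSMul y k z = z := by
      have h1 : Tendsto e.symm (𝓝 (e x)) (𝓝 x) := by
        have := e.continuousAt_symm (e.map_source hxs)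
        rwa [ContinuousAt, e.left_inv hxs] at this
      filter_upwards [h1.eventually hx, e.open_target.mem_nhds (e.map_source hxs)] with z hz hzt
      rw [chartSMul, ← he, hz k hk, e.right_inv hzt]
    have h2 : chartSMul y k =ᶠ[𝓝 (e x)] id := hev
    rw [h2.fderiv_eq, fderiv_id]
  by_contra hne
  exact hfreq (hcont.eventually (isOpen_ne.mem_nhds hne))

/-! ### From fixed frames to derivatives -/

include m in
omit [LieGroup (𝓡 m) ∞ G] in
/-- A transformation that fixes a frame of order at least `1` has the identity as derivative at the
base point. -/
theorem fderiv_chartSMul_eq_id_of_sameJet {ℓ : ℕ} (hℓ : 1 ≤ ℓ) (φ : LocalParam n M) (g : G)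
    (h : LocalParam.SameJet ℓ (φ.postcomp (Diffeomorph.smul (𝓡 m) (𝓡 n) ∞ g)) φ) :
    fderiv ℝ (chartSMul (φ.toFun 0) g)
      (chartAt (EuclideanSpace ℝ (Fin n)) (φ.toFun 0) (φ.toFun 0))
      = ContinuousLinearMap.id ℝ _ := by
  set x := φ.toFun 0 with hx
  set e := chartAt (EuclideanSpace ℝ (Fin n)) x with he
  have hxs : x ∈ e.source := mem_chart_source _ x
  have hxt : e x ∈ e.target := mem_chart_target _ x
  have hsx : e.symm (e x) = x := e.left_inv hxs
  have hgx : g • x = x := h.1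
  have heM : e ∈ IsManifold.maximalAtlas (𝓡 n) ∞ M := IsManifold.chart_mem_maximalAtlas x
  have hjet : fderiv ℝ (e ∘ fun z => g • φ.toFun z) 0 = fderiv ℝ (e ∘ φ.toFun) 0 := by
    -- The order-one entry of the jet exists because `1 ≤ ℓ`.
    have h1 := congrFun (h.2 e heM (by
      change g • x ∈ e.source
      rw [hgx]; exact hxs)) ⟨1, by omega⟩
    have h2 : iteratedFDeriv ℝ 1 (e ∘ fun z => g • φ.toFun z) 0
        = iteratedFDeriv ℝ 1 (e ∘ φ.toFun) 0 := h1
    ext v i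
    have h3 := congrFun (congrArg DFunLike.coe h2) (fun _ => v)
    rw [iteratedFDeriv_one_apply, iteratedFDeriv_one_apply] at h3
    rw [h3]
  have hφ := φ.isLocalDiffeomorphAt
  have hdiff : ∀ k : G, k • x = x → DifferentiableAt ℝ (e ∘ fun z => k • φ.toFun z) 0 := by
    intro k hk
    have h1 : ContMDiffAt (𝓡 n) (𝓡 n) ∞ (fun z => k • φ.toFun z) 0 :=
      (ContMDiffSMul.contMDiff_const_smul (I := 𝓡 m) (I' := 𝓡 n) (M := M) (n := ∞)
        k).contMDiffAt.comp (0 : EuclideanSpace ℝ (Fin n)) hφ.contMDiffAt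
    have h2 : ContMDiffAt (𝓡 n) (𝓡 n) ∞ e (k • φ.toFun 0) := by
      rw [← hx, hk]
      exact contMDiffAt_of_mem_maximalAtlas heM hxs
    exact (contMDiffAt_iff_contDiffAt.1 (h2.comp (0 : EuclideanSpace ℝ (Fin n)) h1)).differentiableAt
      (by simp)
  have hφinv : hφ.localInverse (φ.toFun 0) = 0 := hφ.localInverse_left_inv hφ.localInverse_mem_target
  have hψ : DifferentiableAt ℝ (hφ.localInverse ∘ e.symm) (e x) := by
    have h1 : ContMDiffAt (𝓡 n) (𝓡 n) ∞ e.symm (e x) :=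
      contMDiffAt_symm_of_mem_maximalAtlas heM hxt
    have h2 : ContMDiffAt (𝓡 n) (𝓡 n) ∞ hφ.localInverse (e.symm (e x)) := by
      rw [hsx]
      exact hφ.localInverse_contMDiffAt
    exact (contMDiffAt_iff_contDiffAt.1 (h2.comp (e x) h1)).differentiableAt (by simp)
  have hψ0 : (hφ.localInverse ∘ e.symm) (e x) = 0 := by
    rw [Function.comp_apply, hsx, hx, hφinv]
  -- Near `e x` one has `e ∘ k ∘ e⁻¹ = (e ∘ k ∘ φ) ∘ (φ⁻¹ ∘ e⁻¹)`. The first factor has the same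
  -- derivative for `k = g` and `k = 1`, and for `k = 1` the composite is the identity.
  have hchain : ∀ k : G, k • x = x → fderiv ℝ (chartSMul x k) (e x)
      = (fderiv ℝ (e ∘ fun z => k • φ.toFun z) 0).comp
          (fderiv ℝ (hφ.localInverse ∘ e.symm) (e x)) := by
    intro k hk
    have hsymm : Tendsto e.symm (𝓝 (e x)) (𝓝 x) := by
      have := e.continuousAt_symm hxt
      rwa [ContinuousAt, hsx] at this
    have hev : chartSMul x k =ᶠ[𝓝 (e x)]
        (e ∘ fun z => k • φ.toFun z) ∘ (hφ.localInverse ∘ e.symm) := by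
      filter_upwards [hsymm.eventually hφ.localInverse_eventuallyEq_right] with z hz
      have hz' : φ.toFun (hφ.localInverse (e.symm z)) = e.symm z := hz
      simp only [Function.comp_apply, hz', chartSMul, ← he]
    have hd := hdiff k hk
    rw [← hψ0] at hd
    rw [hev.fderiv_eq, fderiv_comp _ hd hψ, hψ0]
  have hone : chartSMul x (1 : G) =ᶠ[𝓝 (e x)] id := by
    filter_upwards [e.open_target.mem_nhds hxt] with z hz
    rw [chartSMul, ← he, one_smul, e.right_inv hz, id]
  have h1 := hchain 1 (one_smul G x)
  rw [hone.fderiv_eq, fderiv_id] at h1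
  rw [hchain g hgx, hjet, h1]
  simp only [one_smul]

end ChartSMul

theorem mainTheorem7 {m n : ℕ} {G M : Type*}
    [Group G] [TopologicalSpace G] [T2Space G] [ChartedSpace (EuclideanSpace ℝ (Fin m)) G]
    [LieGroup (𝓡 m) ∞ G]
    [TopologicalSpace M] [T2Space M] [ChartedSpace (EuclideanSpace ℝ (Fin n)) M]
    [IsManifold (𝓡 n) ∞ M]
    [MulAction G M] [ContMDiffSMul (𝓡 m) (𝓡 n) ∞ G M]
    (hce : ComponentEffective G M) (ℓ : ℕ) (hℓ : 1 ≤ ℓ) :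
    letI := FrameBundle.prolongedAction m n ℓ G M
    ProperSMul G (FrameBundle n ℓ M) → IsFreeAction G (FrameBundle n ℓ M) := by
  let := FrameBundle.prolongedAction m n ℓ G M
  intro hproper u
  obtain ⟨φ, rfl⟩ := Quotient.exists_rep u
  set u : FrameBundle n ℓ M := FrameBundle.jet ℓ φ with hu
  change MulAction.stabilizer G u = ⊥
  -- The stabilizer is the projection to `G` of the fibre over `(u, u)`.
  have hK : IsCompact (MulAction.stabilizer G u : Set G) := by
    have h1 := (hproper.isProperMap_smul_pair.isCompact_preimage
      (isCompact_singleton (x := (u, u)))).image continuous_fst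
    convert h1 using 1
    ext g
    simp [MulAction.mem_stabilizer_iff]
  have hjet : ∀ k ∈ MulAction.stabilizer G u,
      LocalParam.SameJet ℓ (φ.postcomp (Diffeomorph.smul (𝓡 m) (𝓡 n) ∞ k)) φ :=
    fun k hk => Quotient.exact (MulAction.mem_stabilizer_iff.1 hk)
  have hx : ∀ᶠ x in 𝓝 (φ.toFun 0), ∀ k ∈ MulAction.stabilizer G u, k • x = x :=
    eventually_forall_smul_eq_of_fderiv_eq_id (m := m) (n := n) _ hK _ (fun k hk => (hjet k hk).1)
      (fun k hk => fderiv_chartSMul_eq_id_of_sameJet (m := m) hℓ φ k (hjet k hk))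
  have hsub := (isClopen_setOf_eventually_forall_smul_eq (m := m) (n := n) (M := M) _
    hK).connectedComponent_subset hx
  refine (Subgroup.eq_bot_iff_forall _).2 fun k hk => ?_
  by_contra hne
  obtain ⟨x, hxc, hxk⟩ := hce k hne (φ.toFun 0)
  exact hxk ((hsub hxc).self_of_nhds k hk)
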